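/- **Proposition 6.1.** Let $d\ge 1$ be an integer. For a Lebesgue measurable $f:\mathbb{R}^d\to\mathbb{C}$ let $$\mu(s,f)=\inf\{a\ge 0:\ |\{x\in\mathbb{R}^d:\ |f(x)|>a\}|\le s\},\qquad s>0,$$ be its decreasing rearrangement, and put $$\psi(t)=\begin{cases}\dfrac{1}{\log(e/t)},& 0<t<1,\\[2mm] t,& t\ge 1.\end{cases}$$ Let $\mathtt{M}_\psi(\mathbb{R}^d)$ be the Marcinkiewicz space of all measurable $f$ such that $\{|f|>n\}$ has finite measure for some $n\in\mathbb{N}$ and $$\|f\|_{\mathtt{M}_\psi}:=\sup_{t>0}\frac{1}{\psi(t)}\int_0^t\mu(s,f)\,ds<\infty .$$ Let $J=(1-\Delta)^{-d/4}$, the bounded operator on $L_2(\mathbb{R}^d)$ that acts on the Fourier side as multiplication by $(1+|2\pi\xi|^2)^{-d/4}$ (with $\hat u(\xi)=\int u(t)e^{-2\pi i\langle t,\xi\rangle}dt$), and let $M_f$ be the (in general unbounded) operator of multiplication by $f$. There is a constant $c_d<\infty$, depending only on $d$, such that for every $f\in\mathtt{M}_\psi(\mathbb{R}^d)$ the operator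 $(1-\Delta)^{-d/4}M_f(1-\Delta)^{-d/4}$ is a bounded operator on $L_2(\mathbb{R}^d)$ with operator norm $$\Big\|(1-\Delta)^{-\frac d4}M_f(1-\Delta)^{-\frac d4}\Big\|_\infty\le c_d\,\|f\|_{\mathtt{M}_\psi}.$$ Here this operator is understood as the bounded operator $T$ on $L_2(\mathbb{R}^d)$ that satisfies $\langle Tx,y\rangle=\int_{\mathbb{R}^d}f\cdot (Jx)\cdot\overline{Jy}$ for all $x,y\in L_2(\mathbb{R}^d)$, where the integral converges absolutely; moreover $Tx=J(f\cdot Jx)$ for every $x\in L_2(\mathbb{R}^d)$ with $f\cdot Jx\in L_2(\mathbb{R}^d)$. -/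

import Mathlib

open MeasureTheory FourierTransform
open scoped ENNReal NNReal ComplexConjugate

noncomputable section

/-- `f` belongs to `S(Ω, ν)`: it is `ν`-measurable and, for some `n`, the function
`|f| χ_{|f| > n}` is supported on a set of finite measure. -/
def MemS {Ω : Type*} [MeasurableSpace Ω] (f : Ω → ℂ) (ν : Measure Ω) : Prop :=
  AEStronglyMeasurable f ν ∧ ∃ n : ℕ, ν {x | (n : ℝ) < ‖f x‖} < ∞

/-- The decreasing rearrangement `s ↦ μ(s, f) = inf {a ≥ 0 : ν {|f| > a} ≤ s}`, with values
in `[0, ∞]`; for `f ∈ S(Ω, ν)`, it is equimeasurable with `|f|` on `(0, ∞)`. -/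
def decRearrangement {Ω : Type*} [MeasurableSpace Ω] (f : Ω → ℂ) (ν : Measure Ω)
    (s : ℝ) : ℝ≥0∞ :=
  sInf {a : ℝ≥0∞ | ν {x | a < ‖f x‖ₑ} ≤ ENNReal.ofReal s}

/-- The Marcinkiewicz norm `sup_{t > 0} ψ(t)⁻¹ ∫₀ᵗ μ(s, f) ds`, with values in `[0, ∞]`. -/
def marcinkiewiczNorm {Ω : Type*} [MeasurableSpace Ω] (ψ : ℝ → ℝ) (f : Ω → ℂ)
    (ν : Measure Ω) : ℝ≥0∞ :=
  ⨆ t : ℝ, ⨆ _ : 0 < t,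
    (∫⁻ s in Set.Ioo 0 t, decRearrangement f ν s) / ENNReal.ofReal (ψ t)

/-- Membership in the Marcinkiewicz space `M_ψ(Ω, ν)`. -/
def MemMarcinkiewicz {Ω : Type*} [MeasurableSpace Ω] (ψ : ℝ → ℝ) (f : Ω → ℂ)
    (ν : Measure Ω) : Prop :=
  MemS f ν ∧ marcinkiewiczNorm ψ f ν < ∞

/-- The function `ψ(t) = 1 / log (e / t)` for `t ∈ (0, 1)` and `ψ(t) = t` for `t ≥ 1`.
Only its values at `t > 0` matter. -/
def psiLog (t : ℝ) : ℝ :=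
  if t < 1 then 1 / Real.log (Real.exp 1 / t) else t

/-- The Fourier symbol `(1 + |2πξ|²)^(-d/4)` of `(1 - Δ)^(-d/4)` on `ℝᵈ`, for the Fourier
transform `∫ u(t) e^(-2πi⟨t, ξ⟩) dt`, under which `-Δ` is multiplication by `|2πξ|²`. -/
def besselSymbol (d : ℕ) (ξ : EuclideanSpace ℝ (Fin d)) : ℂ :=
  (((1 + (2 * Real.pi * ‖ξ‖) ^ 2) ^ (-(d : ℝ) / 4) : ℝ) : ℂ)

theorem memLp_besselSymbol (d : ℕ) :
    MemLp (besselSymbol d) ∞ (volume : Measure (EuclideanSpace ℝ (Fin d))) := by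
  have hc : Continuous (besselSymbol d) := by
    unfold besselSymbol
    refine Complex.continuous_ofReal.comp ?_
    refine Continuous.rpow_const (by fun_prop) fun ξ => Or.inl ?_
    positivity
  refine memLp_top_of_bound hc.aestronglyMeasurable 1 (Filter.Eventually.of_forall fun ξ => ?_)
  have h1 : (1 : ℝ) ≤ 1 + (2 * Real.pi * ‖ξ‖) ^ 2 := by
    have := sq_nonneg (2 * Real.pi * ‖ξ‖)
    linarith
  have h2 : -(d : ℝ) / 4 ≤ 0 := by
    have : (0 : ℝ) ≤ d := Nat.cast_nonneg d
    linarith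
  rw [besselSymbol, Complex.norm_real, Real.norm_of_nonneg (by positivity)]
  exact Real.rpow_le_one_of_one_le_of_nonpos h1 h2

/-- The bounded operator `(1 - Δ)^(-d/4)` on `L₂(ℝᵈ)`: Fourier transform, multiplication by
the symbol, inverse Fourier transform. -/
def besselOp (d : ℕ) :
    Lp ℂ 2 (volume : Measure (EuclideanSpace ℝ (Fin d))) →L[ℂ]
      Lp ℂ 2 (volume : Measure (EuclideanSpace ℝ (Fin d))) :=
  ((Lp.fourierTransformₗᵢ (EuclideanSpace ℝ (Fin d)) ℂ).symm.toContinuousLinearEquiv :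
      Lp ℂ 2 (volume : Measure (EuclideanSpace ℝ (Fin d))) →L[ℂ]
        Lp ℂ 2 (volume : Measure (EuclideanSpace ℝ (Fin d)))) ∘L
    ((ContinuousLinearMap.mul ℂ ℂ).holderL volume ∞ 2 2
      ((memLp_besselSymbol d).toLp (besselSymbol d))) ∘L
    ((Lp.fourierTransformₗᵢ (EuclideanSpace ℝ (Fin d)) ℂ).toContinuousLinearEquiv :
      Lp ℂ 2 (volume : Measure (EuclideanSpace ℝ (Fin d))) →L[ℂ]
        Lp ℂ 2 (volume : Measure (EuclideanSpace ℝ (Fin d))))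

/-- The bounded operator `T` on `L₂(ℝᵈ)` realizes `(1 - Δ)^(-d/4) M_f (1 - Δ)^(-d/4)`.
With `J = (1 - Δ)^(-d/4)`:
* `form`: `⟨T x, y⟩ = ∫ f · (J x) · conj (J y)` for all `x, y ∈ L₂`, the integral being
  absolutely convergent (this determines `T`);
* `extends_comp`: `T` extends the literal composition, in which `M_f` is the unbounded
  multiplication operator with its maximal domain `{u ∈ L₂ : f u ∈ L₂}`.

Mathlib's `inner ℂ y z` is conjugate linear in its first argument `y`. -/
structure IsCwikelOperator (d : ℕ) (f : EuclideanSpace ℝ (Fin d) → ℂ)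
    (T : Lp ℂ 2 (volume : Measure (EuclideanSpace ℝ (Fin d))) →L[ℂ]
      Lp ℂ 2 (volume : Measure (EuclideanSpace ℝ (Fin d)))) : Prop where
  form : ∀ x y : Lp ℂ 2 (volume : Measure (EuclideanSpace ℝ (Fin d))),
    Integrable (fun t => f t * besselOp d x t * conj (besselOp d y t)) volume ∧
      inner ℂ y (T x) = ∫ t, f t * besselOp d x t * conj (besselOp d y t)
  extends_comp : ∀ (x : Lp ℂ 2 (volume : Measure (EuclideanSpace ℝ (Fin d))))
    (h : MemLp (fun t => f t * besselOp d x t) 2 volume),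
    T x = besselOp d (h.toLp (fun t => f t * besselOp d x t))

end

/-! Everything reduces to the diagonal bound `∫ |f| |Jx|² ≤ c K ‖x‖²`, where `K` is the
Marcinkiewicz norm of `f`. Given this, write `f = conj(g₁) g₂` with `|g₁| = |g₂| = |f|^(1/2)`. Both
maps `x ↦ gᵢ · Jx` then have norm at most `(cK)^(1/2)`, and `T = A₁* A₂` is the required operator.

The diagonal bound is a critical Sobolev-type estimate. Let `u = Jx` and let `l j` be `‖x‖` plus the
integral of `|symbol · x̂|` over the ball of radius `2^(4^j)`. Frequencies in the ball contribute at
most `l j - ‖x‖` to `|u|` pointwise. By Chebyshev, the remaining frequencies exceed `‖x‖` only on a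
set of measure at most `2^(-4^j)` (`volume_lt_enorm_besselOp_le`). Hence `U j = {|u| > l j}` is so
small that Hardy–Littlewood and `ψ(2^(-4^j)) ≤ 2 · 4^(-j)` give `∫_{U j} |f| ≤ 2K · 4^(-j)`. Cutting
along the first `j` with `t ∉ U j` leaves the sum `∑ 4^(-j) (l j)²`.

The squared symbol has mass at most a constant times `4^j` on the ball of radius `2^(4^j)`, so
termwise Cauchy–Schwarz bounds each summand only by a constant and the sum is not controlled. The
weighted Hardy inequality `tsum_sq_setLIntegral_mul_le` recovers the bound by a multiple of `‖x‖²`.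
-/

/-! ### Cauchy–Schwarz and the `L²` norm as `[0, ∞]`-valued integrals -/

theorem sq_lintegral_mul_le {α : Type*} [MeasurableSpace α] {μ : Measure α} {f g : α → ℝ≥0∞}
    (hf : AEMeasurable f μ) (hg : AEMeasurable g μ) :
    (∫⁻ a, f a * g a ∂μ) ^ 2 ≤ (∫⁻ a, f a ^ 2 ∂μ) * ∫⁻ a, g a ^ 2 ∂μ := by
  have h := ENNReal.lintegral_mul_le_Lp_mul_Lq μ Real.HolderConjugate.two_two hf hg
  simp only [Pi.mul_apply, ENNReal.rpow_two] at h
  refine (pow_le_pow_left₀ (zero_le) h 2).trans_eq ?_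
  rw [mul_pow, ← ENNReal.rpow_natCast, ← ENNReal.rpow_natCast, ← ENNReal.rpow_mul,
    ← ENNReal.rpow_mul]
  norm_num

theorem enorm_sq_eq_lintegral {α E : Type*} [MeasurableSpace α] {μ : Measure α}
    [NormedAddCommGroup E] (f : Lp E 2 μ) : ‖f‖ₑ ^ 2 = ∫⁻ a, ‖f a‖ₑ ^ 2 ∂μ := by
  have h := eLpNorm_nnreal_pow_eq_lintegral (f := f) (p := 2) (μ := μ) two_ne_zero
  rw [Lp.enorm_def]
  simpa using h

/-! ### Pointwise bounds for the inverse Fourier transform on `L²` -/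

section Fourier

variable {E : Type*} [NormedAddCommGroup E] [InnerProductSpace ℝ E] [FiniteDimensional ℝ E]
  [MeasurableSpace E] [BorelSpace E]

theorem integral_fourierInv_smul_eq {φ g : E → ℂ} (hφ : Integrable φ) (hg : Integrable g) :
    ∫ ξ, 𝓕⁻ φ ξ • g ξ = ∫ x, φ x • 𝓕⁻ g x := by
  have h := VectorFourier.integral_fourierIntegral_smul_eq_flip (L := -innerₗ E) (μ := volume)
    (ν := volume) Real.continuous_fourierChar (by simpa using! continuous_inner.neg) hφ hg
  have hflip : (-innerₗ E).flip = -innerₗ E := by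
    ext x y
    simp [real_inner_comm]
  rwa [hflip] at h

/-- On `L¹ ∩ L²`, the `L²` inverse Fourier transform is given by the Fourier integral. -/
theorem fourierInv_ae_eq_of_integrable (g : Lp ℂ 2 (volume : Measure E)) (hg : Integrable g) :
    ⇑(𝓕⁻ g : Lp ℂ 2 (volume : Measure E)) =ᵐ[volume] 𝓕⁻ (⇑g : E → ℂ) := by
  have hcont : Continuous (𝓕⁻ (⇑g : E → ℂ)) :=
    VectorFourier.fourierIntegral_continuous Real.continuous_fourierChar
      (by simpa using! continuous_inner.neg) hg
  -- Both sides are locally integrable, so it suffices to test against smooth compactly supported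
  -- `φ`. These are Schwartz functions, for which the distributional definition of `𝓕⁻` and Fubini
  -- give the same pairing.
  refine ae_eq_of_integral_contDiff_smul_eq
    ((Lp.memLp (𝓕⁻ g : Lp ℂ 2 (volume : Measure E))).locallyIntegrable (by norm_num)) hcont.locallyIntegrable fun φ hφ hs => ?_
  have hs' : HasCompactSupport (Complex.ofRealCLM ∘ φ) := hs.comp_left rfl
  have hφ' : ContDiff ℝ (⊤ : ℕ∞) (Complex.ofRealCLM ∘ φ) :=
    Complex.ofRealCLM.contDiff.comp hφ
  set Φ := hs'.toSchwartzMap hφ'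
  have hΦ : ∀ x, Φ x = (φ x : ℂ) := fun x => rfl
  have h := congrArg (fun T => T Φ) (Lp.fourierInv_toTemperedDistribution_eq g)
  simp only [TemperedDistribution.fourierInv_apply, Lp.toTemperedDistribution_apply] at h
  have h2 := integral_fourierInv_smul_eq (φ := Φ) Φ.integrable hg
  rw [← SchwartzMap.fourierInv_coe, h] at h2
  simpa [hΦ] using h2

/-- Used for the low-frequency part of `Jx`. If `g` is not integrable, the right-hand side is
infinite. -/
theorem enorm_fourierInv_le (g : Lp ℂ 2 (volume : Measure E)) :
    ∀ᵐ x, ‖(𝓕⁻ g : Lp ℂ 2 (volume : Measure E)) x‖ₑ ≤ ∫⁻ ξ, ‖g ξ‖ₑ := by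
  by_cases hg : Integrable g
  · filter_upwards [fourierInv_ae_eq_of_integrable g hg] with x hx
    rw [hx, Real.fourierInv_eq]
    refine (enorm_integral_le_lintegral_enorm _).trans (lintegral_mono fun ξ => ?_)
    rw [Circle.smul_def, enorm_smul, ← ofReal_norm (_ : ℂ), Circle.norm_coe, ENNReal.ofReal_one,
      one_mul]
  · have : ∫⁻ ξ, ‖g ξ‖ₑ = ∞ := by
      by_contra h
      exact hg ⟨(Lp.memLp g).1, lt_top_iff_ne_top.2 h⟩
    simp [this]

end Fourier

/-! ### The Bessel potential on the Fourier side -/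

section Bessel

variable {d : ℕ}

theorem coeFn_fourier_besselOp (x : Lp ℂ 2 (volume : Measure (EuclideanSpace ℝ (Fin d)))) :
    ⇑(𝓕 (besselOp d x) : Lp ℂ 2 _) =ᵐ[volume] fun ξ => besselSymbol d ξ * (𝓕 x : Lp ℂ 2 _) ξ := by
  have h : 𝓕 (besselOp d x) = (ContinuousLinearMap.mul ℂ ℂ).holder 2
      ((memLp_besselSymbol d).toLp (besselSymbol d)) (𝓕 x) :=
    (Lp.fourierTransformₗᵢ (EuclideanSpace ℝ (Fin d)) ℂ).apply_symm_apply _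
  rw [h]
  filter_upwards [ContinuousLinearMap.coeFn_holder (r := 2) (ContinuousLinearMap.mul ℂ ℂ)
    ((memLp_besselSymbol d).toLp (besselSymbol d)) (𝓕 x), (memLp_besselSymbol d).coeFn_toLp]
    with ξ h1 h2
  rw [h1, h2]
  rfl

/-- Plancherel, together with the symbol being real. -/
theorem inner_besselOp_left (x y : Lp ℂ 2 (volume : Measure (EuclideanSpace ℝ (Fin d)))) :
    inner ℂ (besselOp d x) y = inner ℂ x (besselOp d y) := by
  rw [← Lp.inner_fourier_eq, ← Lp.inner_fourier_eq x, L2.inner_def, L2.inner_def]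
  refine integral_congr_ae ?_
  filter_upwards [coeFn_fourier_besselOp x, coeFn_fourier_besselOp y] with ξ hx hy
  rw [hx, hy]
  simp only [RCLike.inner_apply, map_mul, besselSymbol, Complex.conj_ofReal]
  ring

end Bessel

/-! ### Decreasing rearrangements and the Marcinkiewicz norm -/

section Rearrangement

variable {Ω : Type*} [MeasurableSpace Ω] {f : Ω → ℂ} {ν : Measure Ω}

theorem antitone_decRearrangement : Antitone (decRearrangement f ν) := fun _ _ hst =>
  sInf_le_sInf fun _ ha => ha.trans (ENNReal.ofReal_le_ofReal hst)

/-- The infimum is attained: along a decreasing minimizing sequence the level sets increase to the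
limiting one, and measure is continuous from below. -/
theorem measure_decRearrangement_lt_le (s : ℝ) :
    ν {x | decRearrangement f ν s < ‖f x‖ₑ} ≤ ENNReal.ofReal s := by
  have hne : {a : ℝ≥0∞ | ν {x | a < ‖f x‖ₑ} ≤ ENNReal.ofReal s}.Nonempty := ⟨∞, by simp⟩
  obtain ⟨b, hb, hlim, hmem⟩ := exists_seq_tendsto_sInf hne (OrderBot.bddBelow _)
  have hsub : {x | decRearrangement f ν s < ‖f x‖ₑ} ⊆ ⋃ n, {x | b n < ‖f x‖ₑ} := fun x hx =>
    Set.mem_iUnion.2 (hlim.eventually (gt_mem_nhds hx)).exists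
  have hmono : Monotone fun n => {x | b n < ‖f x‖ₑ} := fun m n hmn x hx =>
    lt_of_le_of_lt (hb hmn) hx
  refine (measure_mono hsub).trans ?_
  rw [hmono.directed_le.measure_iUnion]
  exact iSup_le hmem

/-- A form of the Hardy–Littlewood rearrangement inequality. -/
theorem setLIntegral_enorm_le_lintegral_decRearrangement (hf : AEStronglyMeasurable f ν)
    {S : Set Ω} {t : ℝ} (hS : ν S ≤ ENNReal.ofReal t) :
    ∫⁻ x in S, ‖f x‖ₑ ∂ν ≤ ∫⁻ s in Set.Ioo 0 t, decRearrangement f ν s := by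
  -- Layer cake on both sides: the part in `S` of each level set of `|f|` is compared with the level
  -- set of the rearrangement on `(0, t)`, and Tonelli exchanges level and `s`.
  have hmeas : Measurable (decRearrangement f ν) := antitone_decRearrangement.measurable
  have hlevel : ∀ a : ℝ, ν.restrict S {x | a < ‖f x‖} ≤
      ∫⁻ s in Set.Ioo 0 t, {p : ℝ × ℝ | ENNReal.ofReal p.1 ≤ decRearrangement f ν p.2}.indicator
        1 (a, s) := by
    intro a
    set M := ν.restrict S {x | a < ‖f x‖} with hM
    have hMS : M ≤ ENNReal.ofReal t :=
      ((measure_mono (Set.subset_univ _)).trans_eq (Measure.restrict_apply_univ S)).trans hS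
    have hMtop : M ≠ ∞ := ne_top_of_le_ne_top ENNReal.ofReal_ne_top hMS
    rcases le_or_gt t 0 with ht | ht
    · rw [ENNReal.ofReal_of_nonpos ht] at hMS
      exact hMS.trans zero_le
    -- For `s < M`, a level `b < a` is inadmissible in the infimum, since `ν {|f| > b} ≥ M > s`.
    have hsub : Set.Ioo 0 M.toReal ⊆ {s | ENNReal.ofReal a ≤ decRearrangement f ν s} ∩
        Set.Ioo 0 t := by
      intro s hs
      refine ⟨(le_sInf fun b hb => ?_ : ENNReal.ofReal a ≤ decRearrangement f ν s), hs.1,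
        hs.2.trans_le (ENNReal.toReal_le_of_le_ofReal ht.le hMS)⟩
      by_contra! hba
      have h1 : M ≤ ν {x | b < ‖f x‖ₑ} :=
        (Measure.restrict_apply_le _ _).trans (measure_mono fun x hx => hba.trans_le <| by
          rw [← ofReal_norm]; exact ENNReal.ofReal_le_ofReal (le_of_lt hx))
      have h2 := ENNReal.toReal_mono ENNReal.ofReal_ne_top (h1.trans hb)
      rw [ENNReal.toReal_ofReal hs.1.le] at h2
      exact absurd hs.2 (not_lt.2 h2)
    have hset : MeasurableSet {s | ENNReal.ofReal a ≤ decRearrangement f ν s} :=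
      measurableSet_le measurable_const hmeas
    calc M = volume (Set.Ioo 0 M.toReal) := by simp [hMtop]
      _ ≤ volume.restrict (Set.Ioo 0 t) {s | ENNReal.ofReal a ≤ decRearrangement f ν s} := by
        rw [Measure.restrict_apply hset]; exact measure_mono hsub
      _ = ∫⁻ s in Set.Ioo 0 t,
          {s | ENNReal.ofReal a ≤ decRearrangement f ν s}.indicator 1 s :=
        (lintegral_indicator_one hset).symm
      _ = _ := rfl
  have hinner : ∀ s, ∫⁻ a in Set.Ioi 0,
      {p : ℝ × ℝ | ENNReal.ofReal p.1 ≤ decRearrangement f ν p.2}.indicator 1 (a, s) ≤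
        decRearrangement f ν s := by
    intro s
    by_cases htop : decRearrangement f ν s = ∞
    · simp [htop]
    have hset : MeasurableSet {a | ENNReal.ofReal a ≤ decRearrangement f ν s} :=
      measurableSet_le ENNReal.measurable_ofReal measurable_const
    calc _ = ∫⁻ a in Set.Ioi (0 : ℝ),
          {a | ENNReal.ofReal a ≤ decRearrangement f ν s}.indicator 1 a := rfl
      _ = volume ({a | ENNReal.ofReal a ≤ decRearrangement f ν s} ∩ Set.Ioi 0) := by
        rw [lintegral_indicator_one hset, Measure.restrict_apply hset]
      _ ≤ volume (Set.Ioc 0 (decRearrangement f ν s).toReal) :=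
        measure_mono fun a ha => ⟨ha.2, (ENNReal.ofReal_le_iff_le_toReal htop).1 ha.1⟩
      _ = decRearrangement f ν s := by simp [htop]
  calc ∫⁻ x in S, ‖f x‖ₑ ∂ν = ∫⁻ x in S, ENNReal.ofReal ‖f x‖ ∂ν := by simp
    _ = ∫⁻ a in Set.Ioi 0, ν.restrict S {x | a < ‖f x‖} :=
      lintegral_eq_lintegral_meas_lt _ (Filter.Eventually.of_forall fun _ => norm_nonneg _)
        hf.restrict.norm.aemeasurable
    _ ≤ ∫⁻ a in Set.Ioi 0, ∫⁻ s in Set.Ioo 0 t,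
        {p : ℝ × ℝ | ENNReal.ofReal p.1 ≤ decRearrangement f ν p.2}.indicator 1 (a, s) :=
      lintegral_mono fun a => hlevel a
    _ = ∫⁻ s in Set.Ioo 0 t, ∫⁻ a in Set.Ioi 0,
        {p : ℝ × ℝ | ENNReal.ofReal p.1 ≤ decRearrangement f ν p.2}.indicator 1 (a, s) := by
      refine lintegral_lintegral_swap (Measurable.aemeasurable ?_)
      exact measurable_one.indicator (measurableSet_le (by fun_prop) (by fun_prop))
    _ ≤ _ := lintegral_mono hinner

theorem lintegral_decRearrangement_le (ψ : ℝ → ℝ) {t : ℝ} (ht : 0 < t) (hψ : 0 < ψ t) :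
    ∫⁻ s in Set.Ioo 0 t, decRearrangement f ν s ≤
      marcinkiewiczNorm ψ f ν * ENNReal.ofReal (ψ t) :=
  (ENNReal.div_le_iff (ENNReal.ofReal_pos.2 hψ).ne' ENNReal.ofReal_ne_top).1
    (le_iSup₂ (f := fun t (_ : 0 < t) => (∫⁻ s in Set.Ioo 0 t, decRearrangement f ν s) /
      ENNReal.ofReal (ψ t)) t ht)

theorem setLIntegral_enorm_le_marcinkiewiczNorm_mul {ψ : ℝ → ℝ} (hf : AEStronglyMeasurable f ν)
    {S : Set Ω} {t : ℝ} (ht : 0 < t) (hψ : 0 < ψ t) (hS : ν S ≤ ENNReal.ofReal t) :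
    ∫⁻ x in S, ‖f x‖ₑ ∂ν ≤ marcinkiewiczNorm ψ f ν * ENNReal.ofReal (ψ t) :=
  (setLIntegral_enorm_le_lintegral_decRearrangement hf hS).trans
    (lintegral_decRearrangement_le ψ ht hψ)

theorem psiLog_one : psiLog 1 = 1 := by simp [psiLog]

/-- By monotonicity `μ(1, f)` is at most the mean of `μ(s, f)` over `(0, 1)`, and `ψ(1) = 1`. -/
theorem decRearrangement_one_le_marcinkiewiczNorm :
    decRearrangement f ν 1 ≤ marcinkiewiczNorm psiLog f ν := by
  have h := lintegral_decRearrangement_le (f := f) (ν := ν) psiLog one_pos (by simp [psiLog_one])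
  rw [psiLog_one, ENNReal.ofReal_one, mul_one] at h
  refine le_trans ?_ h
  calc decRearrangement f ν 1 = ∫⁻ _ in Set.Ioo (0 : ℝ) 1, decRearrangement f ν 1 := by simp
    _ ≤ _ := setLIntegral_mono' measurableSet_Ioo fun s hs => antitone_decRearrangement hs.2.le

theorem psiLog_two_inv_pow_le {n : ℕ} (hn : 0 < n) :
    0 < psiLog ((2 : ℝ)⁻¹ ^ n) ∧ psiLog ((2 : ℝ)⁻¹ ^ n) ≤ 2 * (n : ℝ)⁻¹ := by
  have hlt : (2 : ℝ)⁻¹ ^ n < 1 := pow_lt_one₀ (by norm_num) (by norm_num) hn.ne'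
  have hn' : (0 : ℝ) < n := by exact_mod_cast hn
  have hlog : Real.log (Real.exp 1 / (2 : ℝ)⁻¹ ^ n) = 1 + n * Real.log 2 := by
    rw [Real.log_div (Real.exp_pos 1).ne' (by positivity), Real.log_exp, Real.log_pow,
      Real.log_inv]
    ring
  have h2 := Real.log_two_gt_d9
  rw [psiLog, if_pos hlt, hlog]
  have hpos : (n : ℝ) / 2 < 1 + n * Real.log 2 := by nlinarith
  refine ⟨by positivity, ?_⟩
  calc 1 / (1 + n * Real.log 2) ≤ 1 / ((n : ℝ) / 2) :=
        one_div_le_one_div_of_le (by positivity) hpos.le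
    _ = 2 * (n : ℝ)⁻¹ := by field_simp

end Rearrangement

/-! ### A weighted Hardy inequality along an exhaustion -/

/-- The summand `1` makes the induction close: splitting off `i = 0` shows that the left-hand side
exactly doubles from `j` to `j + 1`. -/
theorem tsum_two_inv_pow_mul_four_pow_min (j : ℕ) :
    ∑' i : ℕ, (2 : ℝ≥0∞)⁻¹ ^ i * 4 ^ min i j + 1 ≤ 3 * 2 ^ j := by
  have h22 : (2 : ℝ≥0∞)⁻¹ * 4 = 2 := by
    rw [show (4 : ℝ≥0∞) = 2 * 2 by norm_num, ← mul_assoc,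
      ENNReal.inv_mul_cancel two_ne_zero ENNReal.ofNat_ne_top, one_mul]
  induction j with
  | zero =>
    simp only [Nat.min_zero, pow_zero, mul_one, ENNReal.tsum_geometric, ENNReal.one_sub_inv_two,
      inv_inv]
    norm_num
  | succ j ih =>
    have hstep : ∀ i : ℕ, (2 : ℝ≥0∞)⁻¹ ^ (i + 1) * 4 ^ min (i + 1) (j + 1) =
        2 * (2⁻¹ ^ i * 4 ^ min i j) := fun i => by
      rw [Nat.add_min_add_right, pow_succ, pow_succ]
      nth_rewrite 3 [← h22]
      ring
    rw [tsum_eq_zero_add' ENNReal.summable]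
    simp only [hstep, ENNReal.tsum_mul_left]
    calc _ = 2 * (∑' i : ℕ, (2 : ℝ≥0∞)⁻¹ ^ i * 4 ^ min i j + 1) := by simp; ring
      _ ≤ 2 * (3 * 2 ^ j) := by gcongr
      _ = _ := by ring

/-- A weighted Cauchy–Schwarz estimate of Hardy type, along an exhaustion `S` on which the `L²`
norms of `a` grow geometrically. -/
theorem tsum_sq_setLIntegral_mul_le {α : Type*} [MeasurableSpace α] {μ : Measure α}
    {a b : α → ℝ≥0∞} (ha : AEMeasurable a μ) (hb : AEMeasurable b μ) {S : ℕ → Set α}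
    (hS : ∀ j, MeasurableSet (S j)) (hmono : Monotone S) (hcov : ∀ x, ∃ j, x ∈ S j) {C : ℝ≥0∞}
    (hC : ∀ j, ∫⁻ x in S j, a x ^ 2 ∂μ ≤ C * 4 ^ j) :
    ∑' j : ℕ, (4 : ℝ≥0∞)⁻¹ ^ j * (∫⁻ x in S j, a x * b x ∂μ) ^ 2 ≤
      3 * C * ∫⁻ x, b x ^ 2 ∂μ := by
  -- The Cauchy–Schwarz weight, comparable to `2^(-i)` on `S i \ S (i - 1)`. It makes `∫_{S j} a² q`
  -- grow only like `2^j`, and after summation in `j` the factors `4^(-j) 2^j = 2^(-j)` rebuild `q`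
  -- exactly, cancelling `q⁻¹`.
  set q : α → ℝ≥0∞ := fun x => ∑' i : ℕ, 2⁻¹ ^ i * (S i).indicator 1 x with hq
  have hqm : Measurable q := by
    refine Measurable.tsum fun i => ?_
    exact (measurable_one.indicator (hS i)).const_mul _
  have hq_top : ∀ x, q x ≠ ∞ := fun x => by
    refine ne_top_of_le_ne_top (b := ∑' i : ℕ, (2 : ℝ≥0∞)⁻¹ ^ i) ?_ ?_
    · simp [ENNReal.tsum_geometric, ENNReal.one_sub_inv_two]
    · refine ENNReal.tsum_le_tsum fun i => ?_
      exact mul_le_of_le_one_right zero_le (Set.indicator_le_self' (by simp) x)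
  have hq_zero : ∀ x, q x ≠ 0 := fun x => by
    obtain ⟨j, hj⟩ := hcov x
    rw [hq, Ne, ENNReal.tsum_eq_zero, not_forall]
    exact ⟨j, by simp [hj]⟩
  have hsq : ∀ x, (q x ^ (1 / 2 : ℝ)) ^ 2 = q x := fun x => by
    rw [← ENNReal.rpow_natCast, ← ENNReal.rpow_mul]; norm_num
  have hweight : ∀ j, ∫⁻ x in S j, a x ^ 2 * q x ∂μ ≤ 3 * C * 2 ^ j := by
    intro j
    have hterm : ∀ i : ℕ, ∫⁻ x in S j, a x ^ 2 * (2⁻¹ ^ i * (S i).indicator 1 x) ∂μ ≤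
        C * (2⁻¹ ^ i * 4 ^ min i j) := by
      intro i
      calc ∫⁻ x in S j, a x ^ 2 * (2⁻¹ ^ i * (S i).indicator 1 x) ∂μ
          = ∫⁻ x in S j, 2⁻¹ ^ i * (S i).indicator (fun x => a x ^ 2) x ∂μ := by
            refine lintegral_congr fun x => ?_
            by_cases hx : x ∈ S i <;> simp [hx, mul_comm]
        _ = 2⁻¹ ^ i * ∫⁻ x in S (min i j), a x ^ 2 ∂μ := by
            rw [lintegral_const_mul' _ _ (by finiteness), lintegral_indicator (hS i),
              Measure.restrict_restrict (hS i)]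
            congr 3
            rcases le_total i j with h | h
            · simp [h, Set.inter_eq_left.2 (hmono h)]
            · simp [h, Set.inter_eq_right.2 (hmono h)]
        _ ≤ 2⁻¹ ^ i * (C * 4 ^ min i j) := by gcongr; exact hC _
        _ = _ := by ring
    calc ∫⁻ x in S j, a x ^ 2 * q x ∂μ
        = ∑' i : ℕ, ∫⁻ x in S j, a x ^ 2 * (2⁻¹ ^ i * (S i).indicator 1 x) ∂μ := by
          simp_rw [hq, ← ENNReal.tsum_mul_left]
          refine lintegral_tsum fun i => ?_
          exact (ha.restrict.pow_const 2).mul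
            ((measurable_one.indicator (hS i)).const_mul _).aemeasurable
      _ ≤ ∑' i : ℕ, C * (2⁻¹ ^ i * 4 ^ min i j) := ENNReal.tsum_le_tsum hterm
      _ = C * ∑' i : ℕ, 2⁻¹ ^ i * 4 ^ min i j := ENNReal.tsum_mul_left
      _ ≤ C * (3 * 2 ^ j) := by
          gcongr
          exact le_self_add.trans (tsum_two_inv_pow_mul_four_pow_min j)
      _ = _ := by ring
  have hCS : ∀ j, (∫⁻ x in S j, a x * b x ∂μ) ^ 2 ≤
      3 * C * 2 ^ j * ∫⁻ x, (S j).indicator 1 x * (b x ^ 2 * (q x)⁻¹) ∂μ := by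
    intro j
    have hrw : ∀ x, a x * b x = (a x * q x ^ (1 / 2 : ℝ)) * (b x * (q x ^ (1 / 2 : ℝ))⁻¹) := by
      intro x
      have h0 : q x ^ (1 / 2 : ℝ) ≠ 0 := by simp [hq_zero x, hq_top x]
      have h1 : q x ^ (1 / 2 : ℝ) ≠ ∞ := by simp [hq_zero x, hq_top x]
      calc a x * b x = a x * b x * (q x ^ (1 / 2 : ℝ) * (q x ^ (1 / 2 : ℝ))⁻¹) := by
            rw [ENNReal.mul_inv_cancel h0 h1, mul_one]
        _ = _ := by ring
    have hqr : Measurable fun x => q x ^ (1 / 2 : ℝ) := hqm.pow_const _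
    calc (∫⁻ x in S j, a x * b x ∂μ) ^ 2
        = (∫⁻ x in S j, (a x * q x ^ (1 / 2 : ℝ)) * (b x * (q x ^ (1 / 2 : ℝ))⁻¹) ∂μ) ^ 2 := by
          simp_rw [← hrw]
      _ ≤ (∫⁻ x in S j, (a x * q x ^ (1 / 2 : ℝ)) ^ 2 ∂μ) *
          ∫⁻ x in S j, (b x * (q x ^ (1 / 2 : ℝ))⁻¹) ^ 2 ∂μ :=
          sq_lintegral_mul_le (ha.restrict.mul hqr.aemeasurable)
            (hb.restrict.mul hqr.inv.aemeasurable)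
      _ = (∫⁻ x in S j, a x ^ 2 * q x ∂μ) * ∫⁻ x in S j, b x ^ 2 * (q x)⁻¹ ∂μ := by
          simp_rw [mul_pow, ← ENNReal.inv_pow, hsq]
      _ ≤ 3 * C * 2 ^ j * ∫⁻ x in S j, b x ^ 2 * (q x)⁻¹ ∂μ := by gcongr; exact hweight j
      _ = _ := by
          rw [← lintegral_indicator (hS j)]
          congr 2 with x
          by_cases hx : x ∈ S j <;> simp [hx]
  have h42 : ∀ j : ℕ, (4 : ℝ≥0∞)⁻¹ ^ j * 2 ^ j = 2⁻¹ ^ j := fun j => by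
    rw [← mul_pow]
    congr 1
    rw [show (4 : ℝ≥0∞) = 2 * 2 by norm_num, ENNReal.mul_inv (by simp) (by simp), mul_assoc,
      ENNReal.inv_mul_cancel two_ne_zero ENNReal.ofNat_ne_top, mul_one]
  have hm : AEMeasurable (fun x => b x ^ 2 * (q x)⁻¹) μ :=
    (hb.pow_const 2).mul hqm.inv.aemeasurable
  calc ∑' j : ℕ, (4 : ℝ≥0∞)⁻¹ ^ j * (∫⁻ x in S j, a x * b x ∂μ) ^ 2
      ≤ ∑' j : ℕ, 3 * C * ∫⁻ x, 2⁻¹ ^ j * (S j).indicator 1 x * (b x ^ 2 * (q x)⁻¹) ∂μ := by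
        refine ENNReal.tsum_le_tsum fun j => ?_
        simp_rw [mul_assoc ((2 : ℝ≥0∞)⁻¹ ^ j)]
        rw [lintegral_const_mul' _ _ (by finiteness), ← h42]
        calc _ ≤ 4⁻¹ ^ j * (3 * C * 2 ^ j *
              ∫⁻ x, (S j).indicator 1 x * (b x ^ 2 * (q x)⁻¹) ∂μ) := by gcongr; exact hCS j
          _ = _ := by ring
    _ = 3 * C * ∫⁻ x, ∑' j : ℕ, 2⁻¹ ^ j * (S j).indicator 1 x * (b x ^ 2 * (q x)⁻¹) ∂μ := by
        rw [ENNReal.tsum_mul_left, lintegral_tsum fun j => ?_]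
        exact (((measurable_one.indicator (hS j)).const_mul _).aemeasurable).mul hm
    _ = 3 * C * ∫⁻ x, b x ^ 2 ∂μ := by
        congr 1
        refine lintegral_congr fun x => ?_
        rw [ENNReal.tsum_mul_right]
        change q x * _ = _
        rw [mul_comm, mul_assoc, ENNReal.inv_mul_cancel (hq_zero x) (hq_top x), mul_one]

/-! ### Size of the symbol -/

section Symbol

variable {d : ℕ}

theorem continuous_besselSymbol : Continuous (besselSymbol d) := by
  unfold besselSymbol
  refine Complex.continuous_ofReal.comp (Continuous.rpow_const (by fun_prop) fun ξ => Or.inl ?_)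
  positivity

theorem enorm_besselSymbol_sq (ξ : EuclideanSpace ℝ (Fin d)) :
    ‖besselSymbol d ξ‖ₑ ^ 2 =
      ENNReal.ofReal ((1 + (2 * Real.pi * ‖ξ‖) ^ 2) ^ (-(d : ℝ) / 2)) := by
  have hpos : 0 < 1 + (2 * Real.pi * ‖ξ‖) ^ 2 := by positivity
  rw [← ofReal_norm, ← ENNReal.ofReal_pow (norm_nonneg _), besselSymbol, Complex.norm_real,
    Real.norm_of_nonneg (by positivity), ← Real.rpow_natCast, ← Real.rpow_mul hpos.le]
  congr 2
  push_cast
  ring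

theorem enorm_besselSymbol_sq_le_one (ξ : EuclideanSpace ℝ (Fin d)) :
    ‖besselSymbol d ξ‖ₑ ^ 2 ≤ 1 := by
  rw [enorm_besselSymbol_sq]
  refine ENNReal.ofReal_le_one.2 (Real.rpow_le_one_of_one_le_of_nonpos ?_ ?_)
  · nlinarith [sq_nonneg (2 * Real.pi * ‖ξ‖)]
  · have : (0 : ℝ) ≤ d := d.cast_nonneg
    linarith

theorem enorm_besselSymbol_sq_le {s : ℝ} (hs : 0 < s) {ξ : EuclideanSpace ℝ (Fin d)}
    (hξ : s ≤ ‖ξ‖) : ‖besselSymbol d ξ‖ₑ ^ 2 ≤ ENNReal.ofReal ((s ^ d)⁻¹) := by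
  rw [enorm_besselSymbol_sq]
  refine ENNReal.ofReal_le_ofReal ?_
  have hbase : s ^ 2 ≤ 1 + (2 * Real.pi * ‖ξ‖) ^ 2 := by
    have h1 : s ≤ 2 * Real.pi * ‖ξ‖ := by nlinarith [Real.pi_gt_three]
    nlinarith
  calc (1 + (2 * Real.pi * ‖ξ‖) ^ 2) ^ (-(d : ℝ) / 2) ≤ (s ^ 2) ^ (-(d : ℝ) / 2) := by
        refine Real.rpow_le_rpow_of_nonpos (by positivity) hbase ?_
        have : (0 : ℝ) ≤ d := d.cast_nonneg
        linarith
    _ = (s ^ d)⁻¹ := by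
        rw [← Real.rpow_natCast s 2, ← Real.rpow_mul hs.le, ← Real.rpow_natCast s d,
          ← Real.rpow_neg hs.le]
        congr 1
        push_cast
        ring

/-- The exponent is critical: on the shell `2^n ≤ |ξ| < 2^(n+1)` the squared symbol is at most
`2^(-nd)`, so every shell contributes at most `2^d` times the volume of the unit ball. The growth is
thus logarithmic in the radius, matching the logarithm in `ψ`. -/
theorem setLIntegral_besselSymbol_sq_le (n : ℕ) :
    ∫⁻ ξ in Metric.ball (0 : EuclideanSpace ℝ (Fin d)) (2 ^ n), ‖besselSymbol d ξ‖ₑ ^ 2 ≤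
      volume (Metric.ball (0 : EuclideanSpace ℝ (Fin d)) 1) * (1 + n * 2 ^ d) := by
  induction n with
  | zero =>
    calc _ ≤ ∫⁻ _ in Metric.ball (0 : EuclideanSpace ℝ (Fin d)) (2 ^ 0), (1 : ℝ≥0∞) :=
          lintegral_mono enorm_besselSymbol_sq_le_one
      _ = _ := by simp
  | succ n ih =>
    set B : ℕ → Set (EuclideanSpace ℝ (Fin d)) := fun n => Metric.ball 0 (2 ^ n) with hB
    have hcover : B (n + 1) ⊆ B n ∪ (B (n + 1) \ B n) := by simp
    have hvol : volume (B (n + 1)) = ENNReal.ofReal ((2 ^ (n + 1)) ^ d) *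
        volume (Metric.ball (0 : EuclideanSpace ℝ (Fin d)) 1) := by
      have h := Measure.addHaar_ball_of_pos (volume : Measure (EuclideanSpace ℝ (Fin d))) 0
        (r := 2 ^ (n + 1)) (by positivity)
      simpa using h
    have hann : ∫⁻ ξ in B (n + 1) \ B n, ‖besselSymbol d ξ‖ₑ ^ 2 ≤
        volume (Metric.ball (0 : EuclideanSpace ℝ (Fin d)) 1) * 2 ^ d := by
      calc _ ≤ ∫⁻ _ in B (n + 1) \ B n, ENNReal.ofReal (((2 ^ n) ^ d)⁻¹) := by
            refine setLIntegral_mono' (measurableSet_ball.diff measurableSet_ball) fun ξ hξ => ?_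
            exact enorm_besselSymbol_sq_le (by positivity) (by simpa [hB] using hξ.2)
        _ ≤ ENNReal.ofReal (((2 ^ n) ^ d)⁻¹) * volume (B (n + 1)) := by
            rw [setLIntegral_const]
            gcongr
            exact Set.sdiff_subset
        _ = _ := by
            rw [hvol, ← mul_assoc, ← ENNReal.ofReal_mul (by positivity), mul_comm (volume _)]
            congr 1
            rw [pow_succ, mul_pow, inv_mul_cancel_left₀ (by positivity),
              ENNReal.ofReal_pow (by norm_num)]
            simp
    calc _ ≤ ∫⁻ ξ in B n ∪ (B (n + 1) \ B n), ‖besselSymbol d ξ‖ₑ ^ 2 := lintegral_mono_set hcover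
      _ ≤ _ := lintegral_union_le _ _ _
      _ ≤ _ := add_le_add ih hann
      _ = _ := by push_cast; ring

end Symbol

/-! ### The diagonal estimate -/

section Estimate

variable {d : ℕ}

theorem enorm_besselOp_sq_le (x : Lp ℂ 2 (volume : Measure (EuclideanSpace ℝ (Fin d)))) :
    ‖besselOp d x‖ₑ ^ 2 ≤ ‖x‖ₑ ^ 2 := by
  have h : ∀ y : Lp ℂ 2 (volume : Measure (EuclideanSpace ℝ (Fin d))),
      ‖y‖ₑ = ‖(𝓕 y : Lp ℂ 2 (volume : Measure (EuclideanSpace ℝ (Fin d))))‖ₑ := fun y => by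
    rw [← ofReal_norm, ← ofReal_norm, Lp.norm_fourier_eq]
  rw [h x, h (besselOp d x), enorm_sq_eq_lintegral, enorm_sq_eq_lintegral]
  refine lintegral_mono_ae ?_
  filter_upwards [coeFn_fourier_besselOp x] with ξ hξ
  rw [hξ, enorm_mul, mul_pow]
  exact mul_le_of_le_one_left zero_le (enorm_besselSymbol_sq_le_one ξ)

/-- The low frequencies of `(1 - Δ)^(-d/4) x` are bounded pointwise, the high frequencies are
controlled by Chebyshev's inequality. -/
theorem volume_lt_enorm_besselOp_le (x : Lp ℂ 2 (volume : Measure (EuclideanSpace ℝ (Fin d))))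
    {r : ℝ} (hr : 0 < r) :
    volume {t | (∫⁻ ξ in Metric.ball 0 r, ‖besselSymbol d ξ‖ₑ *
        ‖(𝓕 x : Lp ℂ 2 (volume : Measure (EuclideanSpace ℝ (Fin d)))) ξ‖ₑ) + ‖x‖ₑ <
          ‖besselOp d x t‖ₑ} ≤ ENNReal.ofReal ((r ^ d)⁻¹) := by
  set E := EuclideanSpace ℝ (Fin d)
  -- The Chebyshev step cancels `‖x‖²`, so `x = 0` is treated separately.
  rcases eq_or_ne x 0 with rfl | hx
  · refine (measure_eq_zero_iff_ae_notMem.2 ?_).le.trans zero_le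
    filter_upwards [Lp.coeFn_zero ℂ 2 (volume : Measure E)] with t _
    simp
  set g : Lp ℂ 2 (volume : Measure E) := 𝓕 (besselOp d x) with hg
  set xh : Lp ℂ 2 (volume : Measure E) := 𝓕 x with hxh
  set B : Set E := Metric.ball 0 r
  have hB : MeasurableSet B := measurableSet_ball
  have hlo : MemLp (B.indicator g) 2 volume := (Lp.memLp g).indicator hB
  have hhi : MemLp (Bᶜ.indicator g) 2 volume := (Lp.memLp g).indicator hB.compl
  have hsplit : g = hlo.toLp + hhi.toLp := by
    rw [← MemLp.toLp_add]
    refine Lp.ext ?_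
    filter_upwards [(hlo.add hhi).coeFn_toLp] with ξ hξ
    rw [hξ, Set.indicator_self_add_compl]
  have hsum : besselOp d x = 𝓕⁻ hlo.toLp + 𝓕⁻ hhi.toLp := by
    rw [← fourierInv_add, ← hsplit, hg, fourierInv_fourier_eq]
  have hlow : ∫⁻ ξ, ‖hlo.toLp (B.indicator g) ξ‖ₑ = ∫⁻ ξ in B, ‖besselSymbol d ξ‖ₑ * ‖xh ξ‖ₑ := by
    rw [← lintegral_indicator hB]
    refine lintegral_congr_ae ?_
    filter_upwards [hlo.coeFn_toLp, coeFn_fourier_besselOp x] with ξ h1 h2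
    have h3 : g ξ = besselSymbol d ξ * xh ξ := h2
    rw [h1]
    by_cases hξ : ξ ∈ B <;> simp [hξ, h3]
  have hhigh : ‖(𝓕⁻ (hhi.toLp (Bᶜ.indicator g)) : Lp ℂ 2 (volume : Measure E))‖ₑ ^ 2 ≤
      ENNReal.ofReal ((r ^ d)⁻¹) * ‖x‖ₑ ^ 2 := by
    have h1 : ‖(𝓕⁻ (hhi.toLp (Bᶜ.indicator g)) : Lp ℂ 2 (volume : Measure E))‖ₑ =
        ‖hhi.toLp (Bᶜ.indicator g)‖ₑ := by
      rw [← ofReal_norm, ← ofReal_norm, ← Lp.norm_fourier_eq, fourier_fourierInv_eq]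
    have h2 : ‖x‖ₑ = ‖xh‖ₑ := by rw [← ofReal_norm, ← ofReal_norm, hxh, Lp.norm_fourier_eq]
    rw [h1, h2, enorm_sq_eq_lintegral, enorm_sq_eq_lintegral,
      ← lintegral_const_mul' _ _ ENNReal.ofReal_ne_top]
    refine lintegral_mono_ae ?_
    filter_upwards [hhi.coeFn_toLp, coeFn_fourier_besselOp x] with ξ h1 h2
    rw [h1]
    by_cases hξ : ξ ∈ B
    · simp [hξ]
    · rw [Set.indicator_of_mem (by exact hξ), hg, h2, enorm_mul, mul_pow]
      gcongr
      exact enorm_besselSymbol_sq_le hr (by simpa [B] using hξ)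
  have hx0 : ‖x‖ₑ ^ 2 ≠ 0 := by simpa using hx
  have hxtop : ‖x‖ₑ ^ 2 ≠ ∞ := by finiteness
  have hcheb : ‖x‖ₑ ^ 2 * volume {t | (∫⁻ ξ in B, ‖besselSymbol d ξ‖ₑ * ‖xh ξ‖ₑ) + ‖x‖ₑ <
      ‖besselOp d x t‖ₑ} ≤ ENNReal.ofReal ((r ^ d)⁻¹) * ‖x‖ₑ ^ 2 := by
    refine le_trans ?_ hhigh
    rw [enorm_sq_eq_lintegral (𝓕⁻ (hhi.toLp (Bᶜ.indicator g)) : Lp ℂ 2 (volume : Measure E))]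
    refine le_trans ?_ (mul_meas_ge_le_lintegral₀
      ((Lp.memLp (𝓕⁻ (hhi.toLp (Bᶜ.indicator g)) : Lp ℂ 2 (volume : Measure E))).1.enorm.pow_const
        2) (‖x‖ₑ ^ 2))
    gcongr 1
    refine measure_mono_ae ?_
    filter_upwards [enorm_fourierInv_le (hlo.toLp (B.indicator g)),
      Lp.coeFn_add (𝓕⁻ (hlo.toLp (B.indicator g)) : Lp ℂ 2 (volume : Measure E))
        (𝓕⁻ (hhi.toLp (Bᶜ.indicator g)))] with t h1 h2 h3
    change _ < _ at h3
    change _ ≤ _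
    rw [hsum, h2] at h3
    rw [hlow] at h1
    -- Where `|Jx|` exceeds the low-frequency bound plus `‖x‖`, the high-frequency part is at least
    -- `‖x‖`.
    have h4 := h3.trans_le ((enorm_add_le _ _).trans (add_le_add_left h1 _))
    refine pow_le_pow_left₀ zero_le ?_ 2
    by_contra! hlt
    exact absurd h4 (not_lt.2 (add_le_add_right hlt.le _))
  rw [mul_comm (ENNReal.ofReal _)] at hcheb
  exact (ENNReal.mul_le_mul_iff_right hx0 hxtop).1 hcheb

/-- Where `|f| ≤ K` the integral is at most `K ‖Jx‖²`. The rest, `G = {|f| > K}`, has measure at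
most `1` and is cut according to the size of `|Jx|`. -/
theorem exists_lintegral_enorm_mul_besselOp_sq_le (hd : 1 ≤ d) :
    ∃ c : ℝ≥0, ∀ f : EuclideanSpace ℝ (Fin d) → ℂ, AEStronglyMeasurable f volume →
      ∀ x : Lp ℂ 2 (volume : Measure (EuclideanSpace ℝ (Fin d))),
        ∫⁻ t, ‖f t‖ₑ * ‖besselOp d x t‖ₑ ^ 2 ≤
          c * marcinkiewiczNorm psiLog f volume * ‖x‖ₑ ^ 2 := by
  set E := EuclideanSpace ℝ (Fin d)
  set C : ℝ≥0∞ := volume (Metric.ball (0 : E) 1) * (1 + 2 ^ d) with hC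
  have hCtop : C ≠ ∞ := ENNReal.mul_ne_top measure_ball_lt_top.ne (by finiteness)
  -- `1` comes from `|f| ≤ K`; `9 = 8 + 1` counts the levels `j ≥ 1` and the level `0`; `4 (3C + 2)`
  -- bounds `W / ‖x‖²`.
  refine ⟨(1 + 9 * (4 * (3 * C + 2))).toNNReal, fun f hf x => ?_⟩
  rw [ENNReal.coe_toNNReal (by finiteness)]
  set K := marcinkiewiczNorm psiLog f volume with hK
  set xh : Lp ℂ 2 (volume : Measure E) := 𝓕 x with hxh
  set u : E → ℂ := ⇑(besselOp d x) with hu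
  have hum : Measurable u := (Lp.stronglyMeasurable _).measurable
  have hfm : AEMeasurable (fun t => ‖f t‖ₑ) volume := hf.enorm
  -- With doubly exponential radii, the symbol mass grows like `4^j` while `ψ` of the exceptional
  -- measure decays like `4^(-j)`.
  set S : ℕ → Set E := fun j => Metric.ball 0 (2 ^ 4 ^ j) with hS
  set l : ℕ → ℝ≥0∞ := fun j => (∫⁻ ξ in S j, ‖besselSymbol d ξ‖ₑ * ‖xh ξ‖ₑ) + ‖x‖ₑ with hl
  set W : ℝ≥0∞ := ∑' j : ℕ, (4 : ℝ≥0∞)⁻¹ ^ j * l j ^ 2 with hW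
  have hWle : W ≤ 4 * (3 * C + 2) * ‖x‖ₑ ^ 2 := by
    have hsymb : ∀ j : ℕ, ∫⁻ ξ in S j, ‖besselSymbol d ξ‖ₑ ^ 2 ≤ C * 4 ^ j := fun j => by
      refine (setLIntegral_besselSymbol_sq_le (4 ^ j)).trans ?_
      rw [hC, mul_assoc]
      gcongr
      push_cast
      rw [add_mul, one_mul, mul_comm (2 ^ d)]
      gcongr
      exact one_le_pow₀ (by norm_num)
    have hsum := tsum_sq_setLIntegral_mul_le (μ := volume) (a := fun ξ => ‖besselSymbol d ξ‖ₑ)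
      (b := fun ξ => ‖xh ξ‖ₑ) (S := S) continuous_besselSymbol.enorm.aemeasurable
      (Lp.memLp xh).1.enorm (fun j => measurableSet_ball)
      (fun i j hij => Metric.ball_subset_ball (by gcongr <;> norm_num))
      (fun ξ => by
        obtain ⟨n, hn⟩ := pow_unbounded_of_one_lt ‖ξ‖ (one_lt_two : (1 : ℝ) < 2)
        refine ⟨n, ?_⟩
        have : n ≤ 4 ^ n := (Nat.lt_pow_self (by norm_num)).le
        simpa [hS] using hn.trans_le (pow_le_pow_right₀ (by norm_num) this)) hsymb
    have hnorm : ∫⁻ ξ, ‖xh ξ‖ₑ ^ 2 = ‖x‖ₑ ^ 2 := by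
      rw [← enorm_sq_eq_lintegral, ← ofReal_norm, ← ofReal_norm, hxh, Lp.norm_fourier_eq]
    rw [hnorm] at hsum
    have hadd : ∀ a b : ℝ≥0∞, (a + b) ^ 2 ≤ 4 * (a ^ 2 + b ^ 2) := fun a b => by
      rcases le_total a b with h | h
      · calc (a + b) ^ 2 ≤ (b + b) ^ 2 := by gcongr
          _ = 4 * b ^ 2 := by ring
          _ ≤ _ := by gcongr; exact le_add_self
      · calc (a + b) ^ 2 ≤ (a + a) ^ 2 := by gcongr
          _ = 4 * a ^ 2 := by ring
          _ ≤ _ := by gcongr; exact le_self_add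
    have hgeom : ∑' j : ℕ, (4 : ℝ≥0∞)⁻¹ ^ j ≤ 2 := by
      calc ∑' j : ℕ, (4 : ℝ≥0∞)⁻¹ ^ j ≤ ∑' j : ℕ, (2 : ℝ≥0∞)⁻¹ ^ j := by
            gcongr; norm_num
        _ = 2 := by simp [ENNReal.tsum_geometric, ENNReal.one_sub_inv_two]
    calc W ≤ ∑' j : ℕ, 4 * ((4 : ℝ≥0∞)⁻¹ ^ j *
            (∫⁻ ξ in S j, ‖besselSymbol d ξ‖ₑ * ‖xh ξ‖ₑ) ^ 2 + 4⁻¹ ^ j * ‖x‖ₑ ^ 2) := by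
          refine ENNReal.tsum_le_tsum fun j => ?_
          calc _ ≤ (4 : ℝ≥0∞)⁻¹ ^ j * (4 * ((∫⁻ ξ in S j, ‖besselSymbol d ξ‖ₑ * ‖xh ξ‖ₑ) ^ 2 +
                ‖x‖ₑ ^ 2)) := by gcongr; exact hadd _ _
            _ = _ := by ring
      _ = 4 * (∑' j : ℕ, (4 : ℝ≥0∞)⁻¹ ^ j *
            (∫⁻ ξ in S j, ‖besselSymbol d ξ‖ₑ * ‖xh ξ‖ₑ) ^ 2 +
              (∑' j : ℕ, (4 : ℝ≥0∞)⁻¹ ^ j) * ‖x‖ₑ ^ 2) := by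
          rw [ENNReal.tsum_mul_left, ENNReal.tsum_add, ENNReal.tsum_mul_right]
      _ ≤ 4 * (3 * C * ‖x‖ₑ ^ 2 + 2 * ‖x‖ₑ ^ 2) := by gcongr
      _ = _ := by ring
  set U : ℕ → Set E := fun j => {t | l j < ‖u t‖ₑ} with hU
  have hUm : ∀ j, MeasurableSet (U j) := fun j => measurableSet_lt measurable_const hum.enorm
  have hUvol : ∀ j, volume (U j) ≤ ENNReal.ofReal ((2 : ℝ)⁻¹ ^ 4 ^ j) := fun j => by
    refine (volume_lt_enorm_besselOp_le x (r := 2 ^ 4 ^ j) (by positivity)).trans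
      (ENNReal.ofReal_le_ofReal ?_)
    rw [inv_pow]
    -- Here `d ≥ 1` enters: `(2^(4^j))^d ≥ 2^(4^j)`.
    refine inv_anti₀ (by positivity) (le_self_pow₀ (one_le_pow₀ (by norm_num)) (by omega))
  have hUf : ∀ j, ∫⁻ t in U j, ‖f t‖ₑ ≤ K * (2 * 4⁻¹ ^ j) := fun j => by
    obtain ⟨h1, h2⟩ := psiLog_two_inv_pow_le (n := 4 ^ j) (by positivity)
    refine (setLIntegral_enorm_le_marcinkiewiczNorm_mul hf (by positivity) h1 (hUvol j)).trans ?_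
    gcongr
    refine (ENNReal.ofReal_le_ofReal h2).trans_eq ?_
    rw [ENNReal.ofReal_mul (by norm_num), ENNReal.ofReal_inv_of_pos (by positivity)]
    simp [ENNReal.inv_pow]
  set G : Set E := {t | K < ‖f t‖ₑ} with hG
  have hGf : ∫⁻ t in G, ‖f t‖ₑ ≤ K := by
    have hGvol : volume G ≤ ENNReal.ofReal 1 := (measure_mono fun t ht =>
      lt_of_le_of_lt decRearrangement_one_le_marcinkiewiczNorm ht).trans
        (measure_decRearrangement_lt_le (f := f) 1)
    have h := setLIntegral_enorm_le_marcinkiewiczNorm_mul (ψ := psiLog) hf one_pos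
      (by simp [psiLog_one]) hGvol
    simpa [psiLog_one] using h
  -- The measures of the `U j` tend to `0`, so almost every point has a first exit index.
  have hexit : ∀ᵐ t, ∃ j, t ∉ U j := by
    have hlim : Filter.Tendsto (fun j : ℕ => ENNReal.ofReal ((2 : ℝ)⁻¹ ^ 4 ^ j)) Filter.atTop
        (nhds 0) := by
      rw [← ENNReal.ofReal_zero]
      refine ENNReal.tendsto_ofReal ((tendsto_pow_atTop_nhds_zero_of_lt_one (by norm_num)
        (by norm_num)).comp (tendsto_pow_atTop_atTop_of_one_lt (by norm_num)))
    have hnull : volume (⋂ j, U j) = 0 := le_antisymm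
      (ge_of_tendsto' hlim fun j => (measure_mono (Set.iInter_subset _ j)).trans (hUvol j)) zero_le
    rw [ae_iff]
    simpa [Set.iInter_ofPred, hU] using hnull
  have hpt : ∀ᵐ t, ‖f t‖ₑ * ‖u t‖ₑ ^ 2 ≤
      (K * ‖u t‖ₑ ^ 2 + ∑' j : ℕ, (U j).indicator (fun t => ‖f t‖ₑ) t * l (j + 1) ^ 2) +
        l 0 ^ 2 * G.indicator (fun t => ‖f t‖ₑ) t := by
    filter_upwards [hexit] with t ht
    -- Off `G` the first term suffices. On `G`, first exit at `0` gives `|u| ≤ l 0`; first exit at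
    -- `i + 1` gives `t ∈ U i` and `|u| ≤ l (i + 1)`.
    by_cases htG : t ∈ G
    swap
    · refine le_add_right (le_add_right ?_)
      gcongr
      exact not_lt.1 htG
    classical
    have hle : ‖u t‖ₑ ≤ l (Nat.find ht) := not_lt.1 (Nat.find_spec ht)
    rcases hj : Nat.find ht with _ | i
    · rw [hj] at hle
      refine le_add_left ?_
      rw [Set.indicator_of_mem htG, mul_comm]
      gcongr
    · rw [hj] at hle
      have hi : t ∈ U i := not_not.1 (Nat.find_min ht (by omega))
      refine le_add_right (le_add_left ?_)
      refine le_trans ?_ (ENNReal.le_tsum i)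
      rw [Set.indicator_of_mem hi]
      gcongr
  -- `8 = 2 · 4`: the `4` shifts `4^(-j)` to `4^(-(j+1))`, aligning the weight with `l (j + 1)`.
  have hUint : ∀ j : ℕ, ∫⁻ t, (U j).indicator (fun t => ‖f t‖ₑ) t * l (j + 1) ^ 2 ≤
      8 * K * ((4 : ℝ≥0∞)⁻¹ ^ (j + 1) * l (j + 1) ^ 2) := fun j => by
    rw [lintegral_mul_const'' _ (hfm.indicator (hUm j)), lintegral_indicator (hUm j)]
    calc _ ≤ K * (2 * 4⁻¹ ^ j) * l (j + 1) ^ 2 := by gcongr; exact hUf j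
      _ = K * (2 * (4 * 4⁻¹) * 4⁻¹ ^ j) * l (j + 1) ^ 2 := by
        rw [ENNReal.mul_inv_cancel (by norm_num) (by norm_num), mul_one]
      _ = _ := by ring
  have htail : ∑' j : ℕ, (4 : ℝ≥0∞)⁻¹ ^ (j + 1) * l (j + 1) ^ 2 ≤ W := by
    rw [hW, tsum_eq_zero_add' (f := fun j : ℕ => (4 : ℝ≥0∞)⁻¹ ^ j * l j ^ 2) ENNReal.summable]
    exact le_add_self
  have hhead : l 0 ^ 2 ≤ W := by
    have h := ENNReal.le_tsum (f := fun j : ℕ => (4 : ℝ≥0∞)⁻¹ ^ j * l j ^ 2) 0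
    rwa [pow_zero, one_mul] at h
  have hum2 : Measurable fun t => K * ‖u t‖ₑ ^ 2 := (hum.enorm.pow_const 2).const_mul K
  have hsm : ∀ j : ℕ, AEMeasurable (fun t => (U j).indicator (fun t => ‖f t‖ₑ) t * l (j + 1) ^ 2)
      (volume : Measure E) := fun j => (hfm.indicator (hUm j)).mul_const _
  calc ∫⁻ t, ‖f t‖ₑ * ‖u t‖ₑ ^ 2
      ≤ ∫⁻ t, (K * ‖u t‖ₑ ^ 2 + ∑' j : ℕ, (U j).indicator (fun t => ‖f t‖ₑ) t * l (j + 1) ^ 2) +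
        l 0 ^ 2 * G.indicator (fun t => ‖f t‖ₑ) t := lintegral_mono_ae hpt
    _ = K * ‖besselOp d x‖ₑ ^ 2 +
          ∑' j : ℕ, (∫⁻ t, (U j).indicator (fun t => ‖f t‖ₑ) t * l (j + 1) ^ 2) +
        l 0 ^ 2 * ∫⁻ t in G, ‖f t‖ₑ := by
      have hGm : NullMeasurableSet G := nullMeasurableSet_lt aemeasurable_const hfm
      rw [lintegral_add_right' _ ((hfm.indicator₀ hGm).const_mul _), lintegral_add_left hum2,
        lintegral_tsum hsm, lintegral_const_mul _ (hum.enorm.pow_const 2),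
        lintegral_const_mul'' _ (hfm.indicator₀ hGm), lintegral_indicator₀ hGm,
        ← enorm_sq_eq_lintegral]
    _ ≤ K * ‖x‖ₑ ^ 2 + ∑' j : ℕ, 8 * K * ((4 : ℝ≥0∞)⁻¹ ^ (j + 1) * l (j + 1) ^ 2) + W * K :=
      add_le_add (add_le_add (mul_le_mul_right (enorm_besselOp_sq_le x) K)
        (ENNReal.tsum_le_tsum hUint)) (mul_le_mul' hhead hGf)
    _ ≤ K * ‖x‖ₑ ^ 2 + 8 * K * W + W * K := by
      rw [ENNReal.tsum_mul_left]
      gcongr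
    _ = K * (‖x‖ₑ ^ 2 + 9 * W) := by ring
    _ ≤ K * (‖x‖ₑ ^ 2 + 9 * (4 * (3 * C + 2) * ‖x‖ₑ ^ 2)) := by gcongr
    _ = _ := by ring

end Estimate

/-! ### From the diagonal bound to the operator -/

/-- A multiplication operator after a bounded operator `J` into `L²` is bounded as soon as it
satisfies a norm bound. -/
theorem exists_continuousLinearMap_ae_eq_mul {α H : Type*} [MeasurableSpace α] {μ : Measure α}
    [NormedAddCommGroup H] [NormedSpace ℂ H] (J : H →L[ℂ] Lp ℂ 2 μ) {g : α → ℂ}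
    (hg : AEStronglyMeasurable g μ) {M : ℝ≥0}
    (hM : ∀ x, ∫⁻ t, ‖g t * J x t‖ₑ ^ 2 ∂μ ≤ (M * ‖x‖ₑ) ^ 2) :
    ∃ A : H →L[ℂ] Lp ℂ 2 μ, (∀ x, A x =ᵐ[μ] fun t => g t * J x t) ∧ ‖A‖ₑ ≤ M := by
  have hmem : ∀ x, MemLp (fun t => g t * J x t) 2 μ := fun x => by
    refine ⟨hg.mul (Lp.memLp _).1, ?_⟩
    have h := eLpNorm_nnreal_pow_eq_lintegral (f := fun t => g t * J x t) (p := 2) (μ := μ)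
      two_ne_zero
    have h2 : eLpNorm (fun t => g t * J x t) 2 μ ^ 2 ≤ (M * ‖x‖ₑ) ^ 2 := by
      refine le_of_eq_of_le ?_ (hM x)
      simpa using h
    refine lt_of_le_of_lt ((ENNReal.pow_le_pow_left_iff two_ne_zero).1 h2) ?_
    finiteness
  have hbound : ∀ x, ‖(hmem x).toLp‖ₑ ≤ M * ‖x‖ₑ := fun x => by
    refine (ENNReal.pow_le_pow_left_iff two_ne_zero).1 (le_trans (le_of_eq ?_) (hM x))
    rw [enorm_sq_eq_lintegral]
    refine lintegral_congr_ae ?_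
    filter_upwards [(hmem x).coeFn_toLp] with t ht
    rw [ht]
  let A₀ : H →ₗ[ℂ] Lp ℂ 2 μ :=
    { toFun := fun x => (hmem x).toLp
      map_add' := fun x y => by
        rw [← MemLp.toLp_add]
        refine MemLp.toLp_congr _ _ ?_
        filter_upwards [Lp.coeFn_add (J x) (J y)] with t ht
        rw [map_add, ht]
        simp only [Pi.add_apply, mul_add]
      map_smul' := fun c x => by
        rw [RingHom.id_apply, ← MemLp.toLp_const_smul]
        refine MemLp.toLp_congr _ _ ?_
        filter_upwards [Lp.coeFn_smul c (J x)] with t ht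
        simp [ht, mul_left_comm] }
  have hA₀ : ∀ x, ‖A₀ x‖ ≤ M * ‖x‖ := fun x => by
    have h := ENNReal.toReal_mono (by finiteness) (hbound x)
    simpa [A₀] using h
  exact ⟨A₀.mkContinuous M hA₀, fun x => (hmem x).coeFn_toLp,
    ContinuousLinearMap.opENorm_le_bound _ hbound⟩

/-- The form `∫ f · (J x) · conj (J y)` is represented by a bounded operator as soon as its absolute
value is bounded on the diagonal. -/
theorem exists_continuousLinearMap_inner_eq_integral {α H : Type*} [MeasurableSpace α]
    {μ : Measure α} [NormedAddCommGroup H] [InnerProductSpace ℂ H] [CompleteSpace H]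
    (J : H →L[ℂ] Lp ℂ 2 μ) {f : α → ℂ} (hf : AEStronglyMeasurable f μ) {D : ℝ≥0}
    (hD : ∀ x, ∫⁻ t, ‖f t‖ₑ * ‖J x t‖ₑ ^ 2 ∂μ ≤ D * ‖x‖ₑ ^ 2) :
    ∃ T : H →L[ℂ] H, (∀ x y, Integrable (fun t => f t * J x t * conj (J y t)) μ ∧
      inner ℂ y (T x) = ∫ t, f t * J x t * conj (J y t) ∂μ) ∧ ‖T‖ₑ ≤ D := by
  set g₁ : α → ℂ := fun t => (√‖f t‖ : ℝ) with hg₁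
  -- `g₂` carries the phase of `f`. At zeros of `f` the quotient `0 / 0` is `0`, so `|g₂| =
  -- |f|^(1/2)` holds everywhere.
  set g₂ : α → ℂ := fun t => f t / (√‖f t‖ : ℝ) with hg₂
  have hsqrt : AEMeasurable (fun t => √‖f t‖) μ := hf.norm.aemeasurable.sqrt
  have hg₁m : AEStronglyMeasurable g₁ μ :=
    (Complex.measurable_ofReal.comp_aemeasurable hsqrt).aestronglyMeasurable
  have hg₂m : AEStronglyMeasurable g₂ μ :=
    (hf.aemeasurable.div (Complex.measurable_ofReal.comp_aemeasurable hsqrt)).aestronglyMeasurable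
  have hn₁ : ∀ t, ‖g₁ t‖ = √‖f t‖ := fun t => by simp [hg₁]
  have hn₂ : ∀ t, ‖g₂ t‖ = √‖f t‖ := fun t => by
    simp [hg₂, abs_of_nonneg (Real.sqrt_nonneg _), Real.div_sqrt]
  have hmul : ∀ t, conj (g₁ t) * g₂ t = f t := fun t => by
    rcases eq_or_ne (f t) 0 with h | h
    · simp [hg₂, h]
    · have h0 : ((√‖f t‖ : ℝ) : ℂ) ≠ 0 := by
        exact_mod_cast (Real.sqrt_pos.2 (norm_pos_iff.2 h)).ne'
      simp only [hg₁, hg₂, Complex.conj_ofReal]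
      exact mul_div_cancel₀ _ h0
  have hM : ∀ g : α → ℂ, (∀ t, ‖g t‖ = √‖f t‖) →
      ∀ x, ∫⁻ t, ‖g t * J x t‖ₑ ^ 2 ∂μ ≤ ((NNReal.sqrt D : ℝ≥0) * ‖x‖ₑ) ^ 2 := by
    intro g hg x
    rw [mul_pow, ← ENNReal.coe_pow, NNReal.sq_sqrt]
    refine le_trans (le_of_eq (lintegral_congr fun t => ?_)) (hD x)
    rw [enorm_mul, mul_pow, ← ofReal_norm (g t), hg, ← ENNReal.ofReal_pow (Real.sqrt_nonneg _),
      Real.sq_sqrt (norm_nonneg _), ofReal_norm]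
  obtain ⟨A₁, hA₁, hA₁n⟩ := exists_continuousLinearMap_ae_eq_mul J hg₁m (hM g₁ hn₁)
  obtain ⟨A₂, hA₂, hA₂n⟩ := exists_continuousLinearMap_ae_eq_mul J hg₂m (hM g₂ hn₂)
  have hae : ∀ x y, (fun t => inner ℂ (A₁ y t) (A₂ x t)) =ᵐ[μ]
      fun t => f t * J x t * conj (J y t) := fun x y => by
    filter_upwards [hA₁ y, hA₂ x] with t h1 h2
    rw [h1, h2, ← hmul t]
    simp only [RCLike.inner_apply, map_mul]
    ring
  refine ⟨ContinuousLinearMap.adjoint A₁ ∘L A₂, fun x y =>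
    ⟨(L2.integrable_inner (𝕜 := ℂ) (A₁ y) (A₂ x)).congr (hae x y), ?_⟩, ?_⟩
  · rw [ContinuousLinearMap.comp_apply, ContinuousLinearMap.adjoint_inner_right, L2.inner_def]
    exact integral_congr_ae (hae x y)
  · have hadj : ‖ContinuousLinearMap.adjoint A₁‖₊ = ‖A₁‖₊ :=
      LinearIsometryEquiv.nnnorm_map ContinuousLinearMap.adjoint A₁
    have h₁ : ‖A₁‖₊ ≤ NNReal.sqrt D := ENNReal.coe_le_coe.1 hA₁n
    have h₂ : ‖A₂‖₊ ≤ NNReal.sqrt D := ENNReal.coe_le_coe.1 hA₂n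
    refine ENNReal.coe_le_coe.2 ((ContinuousLinearMap.opNNNorm_comp_le _ _).trans ?_)
    rw [hadj]
    exact (mul_le_mul' h₁ h₂).trans_eq (NNReal.mul_self_sqrt D)

theorem proposition6p1 (d : ℕ) (hd : 1 ≤ d) :
    ∃ c : ℝ≥0, ∀ f : EuclideanSpace ℝ (Fin d) → ℂ,
      MemMarcinkiewicz psiLog f volume →
        ∃ T : Lp ℂ 2 (volume : Measure (EuclideanSpace ℝ (Fin d))) →L[ℂ]
            Lp ℂ 2 (volume : Measure (EuclideanSpace ℝ (Fin d))),
          IsCwikelOperator d f T ∧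
            ‖T‖ₑ ≤ (c : ℝ≥0∞) * marcinkiewiczNorm psiLog f volume := by
  obtain ⟨c, hc⟩ := exists_lintegral_enorm_mul_besselOp_sq_le hd
  refine ⟨c, fun f hfM => ?_⟩
  obtain ⟨K, hK⟩ := WithTop.ne_top_iff_exists.1 hfM.2.ne
  change (K : ℝ≥0∞) = _ at hK
  obtain ⟨T, hT, hTn⟩ := exists_continuousLinearMap_inner_eq_integral (besselOp d) hfM.1.1
    (D := c * K) fun x => by rw [ENNReal.coe_mul, hK]; exact hc f hfM.1.1 x
  refine ⟨T, ⟨hT, fun x h => ?_⟩, by rwa [ENNReal.coe_mul, hK] at hTn⟩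
  -- If `f · Jx` is in `L²`, self-adjointness of `J` turns `⟨y, J(f · Jx)⟩` into the integral that
  -- defines `⟨y, Tx⟩`.
  refine ext_inner_left ℂ fun y => ?_
  rw [(hT x y).2, ← inner_besselOp_left, L2.inner_def]
  refine integral_congr_ae ?_
  filter_upwards [h.coeFn_toLp] with t ht
  rw [ht, RCLike.inner_apply]
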